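/- All rings are commutative with $1$, and subrings contain the same $1$. A maximal subring of a ring $R$ is a proper subring of $R$ that is maximal with respect to inclusion among all proper subrings of $R$. **Theorem.** Let $E$ be a field. The following conditions are equivalent: 1. $E$ has only finitely many maximal subrings. 2. Every descending chain $\cdots\subset R_2\subset R_1\subset R_0=E$, in which each $R_i$ ($i\ge 1$) is a maximal subring of $R_{i-1}$, is finite; that is, there is no infinite sequence $(R_i)_{i\ge 0}$ of this kind. Suppose that these conditions hold. Then $E$ is algebraic over the field $\mathbb{F}_q$ for some prime number $q$. Let $T=FG(E)$ be the set of all positive integers $n$ such that $E$ contains the field $\mathbb{F}_{q^n}$ with $q^n$ elements (the largest set $T$ of positive integers with $E=\bigcup_{n\in T}\mathbb{F}_{q^n}$). Let $T_f$ be the set of primes $p$ such that $p^n\in T$ and $p^{n+1}\notin T$ for some $n\ge 1$, and let $T_\infty$ be the set of primes $p$ such that $p^n\in T$ for all $n\ge 1$. For $p\in T_f$ let $o_T(p)$ be the greatest $n\ge 1$ with $p^n\in T$ and $p^{n+1}\notin T$. Let $L(E)$ be the subfield of $E$ generated by the fields $\mathbb{F}_{q^n}$, where $n$ runs over the elements of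 $T$ all of whose prime divisors lie in $T_\infty$; it is the largest subfield of $E$ that has no maximal subring. Then $T_f$ is finite, and every chain $E=R_0\supset R_1\supset\cdots\supset R_m$, in which each $R_i$ ($1\le i\le m$) is a maximal subring of $R_{i-1}$ and $R_m$ has no maximal subring, has length $$m=\sum_{p\in T_f}o_T(p)$$ and ends at $R_m=L(E)$. Moreover, there are only finitely many finite chains $E=R_0\supset R_1\supset\cdots\supset R_k$ ($k\ge 0$) in which each $R_i$ ($1\le i\le k$) is a maximal subring of $R_{i-1}$; in particular, only finitely many of them end at a ring without maximal subrings. -/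

import Mathlib

/-- `S` is a maximal subring of the ring `R` (both given as subrings of an ambient ring `A`; the
subrings of `R` are the subrings of `A` contained in `R`): `S` is maximal with respect to inclusion
in the set of all proper subrings of `R`. For `R = ⊤` these are the maximal subrings of `A`. -/
def IsMaximalSubringOf {A : Type*} [CommRing A] (S R : Subring A) : Prop :=
  Maximal (fun U : Subring A => U < R) S

/-- The set of all maximal subrings of the ring `A`. -/
def RgMax (A : Type*) [CommRing A] : Set (Subring A) :=
  {S | IsMaximalSubringOf S ⊤}

/-- The relation "`S` is a maximal subring of `R`", as a set of pairs `(R, S)`. -/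
def maximalSubringRel (A : Type*) [CommRing A] : SetRel (Subring A) (Subring A) :=
  {q | IsMaximalSubringOf q.2 q.1}

/-- A finite descending chain `R₀ = A ⊃ R₁ ⊃ ⋯ ⊃ R_m` (with `m` its `length`, `m = 0` allowed) in
which each `Rᵢ₊₁` is a maximal subring of `Rᵢ`. -/
def IsDescendingChain {A : Type*} [CommRing A] (c : RelSeries (maximalSubringRel A)) : Prop :=
  c.head = ⊤

/-- A finite descending chain that cannot be continued: its last ring has no maximal subring. -/
def IsCompleteDescendingChain {A : Type*} [CommRing A]
    (c : RelSeries (maximalSubringRel A)) : Prop :=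
  IsDescendingChain c ∧ ¬ ∃ S : Subring A, IsMaximalSubringOf S c.last

/-- An infinite descending chain `⋯ ⊂ R₂ ⊂ R₁ ⊂ R₀ = A` in which each `Rᵢ₊₁` is a maximal subring
of `Rᵢ`. -/
def IsInfiniteDescendingChain {A : Type*} [CommRing A] (R : ℕ → Subring A) : Prop :=
  R 0 = ⊤ ∧ ∀ i, IsMaximalSubringOf (R (i + 1)) (R i)

/-- `E` is algebraic over the field with `p` elements for some prime number `p`. -/
def IsAbsolutelyAlgebraic (E : Type*) [Field E] : Prop :=
  ∃ (p : ℕ) (_ : Fact p.Prime) (_ : Algebra (ZMod p) E), Algebra.IsAlgebraic (ZMod p) E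

/-- For an absolutely algebraic field `E` of characteristic `q`, the set `FG(E)` of positive
integers `n` such that `E` contains the field with `q ^ n` elements. It is the largest set `T` of
positive integers with `E = ⋃ n ∈ T, F_{q ^ n}`. -/
def FG (E : Type*) [Field E] : Set ℕ :=
  {n | 0 < n ∧ ∃ K : Subfield E, Nat.card K = ringChar E ^ n}

/-- The finite part `T_f` of a set `T` of positive integers. -/
def finitePart (T : Set ℕ) : Set ℕ :=
  {p | p.Prime ∧ ∃ n : ℕ, 0 < n ∧ p ^ n ∈ T ∧ p ^ (n + 1) ∉ T}

/-- The infinite part `T_∞` of a set `T` of positive integers. -/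
def infinitePart (T : Set ℕ) : Set ℕ :=
  {p | p.Prime ∧ ∀ n : ℕ, 0 < n → p ^ n ∈ T}

open Classical in
/-- The order `o_T(t)`: the greatest positive integer `n`, if it exists, such that `t ^ n ∈ T` and
`t ^ (n + 1) ∉ T`, and `∞` otherwise. -/
noncomputable def fgOrder (T : Set ℕ) (t : ℕ) : ℕ∞ :=
  if h : ∃ n : ℕ, IsGreatest {n : ℕ | 0 < n ∧ t ^ n ∈ T ∧ t ^ (n + 1) ∉ T} n then
    (h.choose : ℕ∞)
  else ⊤

/-- For an `FG`-set `T`, the `FG`-subset `T'` of `T` with `T'_∞ = T_∞` and `T'_f = ∅`: the elements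
of `T` all of whose prime divisors lie in `T_∞`. -/
def infiniteSubset (T : Set ℕ) : Set ℕ :=
  {n | n ∈ T ∧ ∀ p : ℕ, p.Prime → p ∣ n → p ∈ infinitePart T}

/-- For an absolutely algebraic field `E` of characteristic `q`, the subfield `L(E)`: with
`T = FG(E)` and `T'` the `FG`-subset of `T` with `T'_∞ = T_∞` and `T'_f = ∅`, the subfield of `E`
generated by the subfields with `q ^ n` elements, `n ∈ T'`. It is the largest subfield of `E`
that has no maximal subring. -/
def largestNonsubmaximalSubfield (E : Type*) [Field E] : Subfield E :=
  sSup {K : Subfield E | ∃ n ∈ infiniteSubset (FG E), Nat.card K = ringChar E ^ n}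

/-!
The proof separates the fields that are algebraic over a finite prime field from all others.

*Absolutely algebraic fields.* Let `E` be algebraic over `F_q`. Every element `x` has an absolute
degree, its degree over `F_q`, and `x` lies in a subring `S` if and only if its degree occurs in `S`
(`mem_iff_absDegree_mem`). So subrings are determined by their sets of degrees, these sets are
closed under divisors and common multiples, and hence are determined by the prime powers in them:
a subring is the same thing as a Steinitz number. A maximal subring of `R` is obtained by lowering
by one the exponent of one prime that occurs in `R` with finite nonzero exponent
(`isMaximalSubringOf_iff`). Consequently maximal subrings of `E` correspond to the primes in `T_f`,
and each step of a chain lowers the sum of the finite exponents by exactly one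
(`IsMaximalSubringOf.sum_ncard_levels`). If `T_f` is finite this bounds all chains and determines
the length and the last ring of a complete one; if `T_f` is infinite, its primes can be lowered one
after the other for ever.

*Other fields.* If `E` is not absolutely algebraic, it is algebraic over a subring `D` isomorphic to
`ℤ` or to a polynomial ring `K[X]`, a principal ideal domain with infinitely many primes. For each
prime `p` of `D`, a subring of `E` maximal among those that contain `D` but not `1 / p` is a maximal
subring of `E`, so there are infinitely many of these. The same construction inside an integrally
closed subring in place of `E` (`exists_isMaximalSubringOf_inv_notMem`) removes the inverses of the
primes of `D` one by one, which yields an infinite chain. So both conditions fail.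
-/

/-! ### Fields that are not absolutely algebraic -/

open Polynomial in
/-- Euclid's argument: pairwise coprime primes exist in abundance as soon as every nonzero `d`
has a nonzero nonunit in `1 + d D`. -/
theorem exists_seq_prime_pairwise_isCoprime {D : Type*} [CommRing D] [IsDomain D]
    [IsPrincipalIdealRing D]
    (h : ∀ d : D, d ≠ 0 → ∃ c, 1 + d * c ≠ 0 ∧ ¬ IsUnit (1 + d * c)) :
    ∃ p : ℕ → D, (∀ i, Prime (p i)) ∧ Pairwise fun i j => IsCoprime (p i) (p j) := by
  have : Std.Symm (IsCoprime (R := D)) := ⟨fun _ _ => IsCoprime.symm⟩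
  refine exists_seq_of_forall_finset_exists' (fun x : D => Prime x) IsCoprime fun s hs => ?_
  obtain ⟨c, hc0, hcu⟩ := h (∏ x ∈ s, x)
    (Finset.prod_ne_zero_iff.mpr fun x hx => (hs x hx).ne_zero)
  obtain ⟨q, hq, a, ha⟩ := WfDvdMonoid.exists_irreducible_factor hcu hc0
  refine ⟨q, hq.prime, fun x hx => ?_⟩
  obtain ⟨b, hb⟩ := Finset.dvd_prod_of_mem (fun x : D => x) hx
  refine ⟨-(b * c), a, ?_⟩
  rw [hb] at ha
  linear_combination -ha

theorem Subring.inv_mem_of_isIntegral {E : Type*} [Field E] {S : Subring E} {x : E}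
    (hx : x ∈ S) (h : IsIntegral S x⁻¹) : x⁻¹ ∈ S := by
  rcases eq_or_ne x 0 with rfl | hx0
  · simp
  have hu : IsUnit (algebraMap S (integralClosure S E) ⟨x, hx⟩) := by
    refine IsUnit.of_mul_eq_one ⟨x⁻¹, h⟩ ?_
    ext
    exact mul_inv_cancel₀ hx0
  obtain ⟨y, hy⟩ := isUnit_iff_exists_inv.mp (isUnit_of_map_unit _ _ hu)
  have : x * (y : E) = 1 := congrArg Subtype.val hy
  rw [inv_eq_of_mul_eq_one_right this]
  exact y.2

/-- Dependent choice for chains: the predicate `P n` on the `n`-th ring is what allows the next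
step. -/
theorem exists_isInfiniteDescendingChain_of_step {A : Type*} [CommRing A]
    (P : ℕ → Subring A → Prop) (h0 : P 0 ⊤)
    (step : ∀ n R, P n R → ∃ S, P (n + 1) S ∧ IsMaximalSubringOf S R) :
    ∃ R : ℕ → Subring A, IsInfiniteDescendingChain R := by
  choose next hP hnext using step
  let R : ∀ n, {R // P n R} := fun n =>
    Nat.rec ⟨⊤, h0⟩ (fun n R => ⟨next n R.1 R.2, hP n R.1 R.2⟩) n
  exact ⟨fun n => (R n).1, rfl, fun n => hnext n (R n).1 (R n).2⟩

section Transcendental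

variable {D E : Type*} [CommRing D] [IsDomain D] [IsPrincipalIdealRing D] [Field E] [Algebra D E]
  [FaithfulSMul D E] [Algebra.IsAlgebraic D E]

theorem Subring.isIntegral_of_forall_algebraMap_mem {D E : Type*} [CommRing D] [Field E]
    [Algebra D E] {S : Subring E} (hS : ∀ d : D, algebraMap D E d ∈ S) {x : E}
    (hx : IsIntegral D x) : IsIntegral S x := by
  obtain ⟨f, hf, h⟩ := hx
  refine ⟨f.map ((algebraMap D E).codRestrict S hS), hf.map _, ?_⟩
  rw [Polynomial.eval₂_map]
  exact h

/-- If adjoining `y` to `S` inverts `p`, and some multiple `d y` with `d` coprime to `p` is integral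
over `S`, then `p` is already invertible in `S`: a multiple `d ^ n / p` is integral over `S`, and
Bézout turns this into integrality of `1 / p`. -/
theorem Subring.inv_algebraMap_mem_of_mem_adjoin {D E : Type*} [CommRing D] [Field E]
    [Algebra D E] {S : Subring E} (hS : ∀ d : D, algebraMap D E d ∈ S) {p d : D}
    (hp : algebraMap D E p ≠ 0) (hd : IsCoprime d p)
    {y : E} (hy : IsIntegral S (algebraMap D E d * y))
    (h : (algebraMap D E p)⁻¹ ∈ Algebra.adjoin S {y}) : (algebraMap D E p)⁻¹ ∈ S := by
  refine Subring.inv_mem_of_isIntegral (hS p) ?_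
  rw [Algebra.adjoin_singleton_eq_range_aeval] at h
  obtain ⟨f, hf⟩ := h
  replace hf : Polynomial.aeval y f = (algebraMap D E p)⁻¹ := hf
  have hint : IsIntegral S (algebraMap D E d ^ f.natDegree * (algebraMap D E p)⁻¹) := by
    have := Polynomial.scaleRoots_eval₂_mul (f := algebraMap S E) (r := y) (p := f)
      (s := ⟨algebraMap D E d, hS d⟩)
    rw [← hf]
    refine IsIntegral.of_mem_of_fg (Algebra.adjoin S {algebraMap D E d * y})
      hy.fg_adjoin_singleton _ ?_
    rw [Algebra.adjoin_singleton_eq_range_aeval]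
    exact ⟨_, this⟩
  obtain ⟨u, v, huv⟩ := (hd.pow_left (m := f.natDegree))
  have huv' := congrArg (algebraMap D E) huv
  simp only [map_add, map_mul, map_pow, map_one] at huv'
  have heq : (algebraMap D E p)⁻¹ = algebraMap D E u *
      (algebraMap D E d ^ f.natDegree * (algebraMap D E p)⁻¹) + algebraMap D E v := by
    field_simp
    linear_combination -huv'
  rw [heq]
  exact (((isIntegral_algebraMap (R := D) (x := u) : IsIntegral D _) |>
    Subring.isIntegral_of_forall_algebraMap_mem hS).mul hint).add
    (Subring.isIntegral_of_forall_algebraMap_mem hS isIntegral_algebraMap)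

/-- Let `E` be algebraic over a principal ideal domain `D` and let `R ⊇ D` be a subring, integrally
closed in `E`, in which the prime `p` of `D` is invertible. A subring of `R` that is maximal among
those containing `D` but not `1 / p` is a maximal subring of `R`; it is again integrally closed in
`E`, and primes other than `p` that are invertible in `R` remain so. For `R = E` it is a valuation
ring of rank one. -/
theorem exists_isMaximalSubringOf_inv_notMem {R : Subring E} (hD : ∀ d : D, algebraMap D E d ∈ R)
    (hR : ∀ x, IsIntegral R x → x ∈ R) {p : D} (hp : Prime p) (hpR : (algebraMap D E p)⁻¹ ∈ R) :
    ∃ S : Subring E, IsMaximalSubringOf S R ∧ (∀ d : D, algebraMap D E d ∈ S) ∧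
      (∀ x, IsIntegral S x → x ∈ S) ∧ (algebraMap D E p)⁻¹ ∉ S ∧
      ∀ q : D, IsCoprime q p → (algebraMap D E q)⁻¹ ∈ R → (algebraMap D E q)⁻¹ ∈ S := by
  have hinj : Function.Injective (algebraMap D E) := FaithfulSMul.algebraMap_injective D E
  have hp0 : algebraMap D E p ≠ 0 := by
    rw [Ne, map_eq_zero_iff _ hinj]; exact hp.ne_zero
  obtain ⟨S, -, hS⟩ := zorn_le_nonempty₀
    {U : Subring E | U ≤ R ∧ (∀ d : D, algebraMap D E d ∈ U) ∧ (algebraMap D E p)⁻¹ ∉ U}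
    (by
      intro c hc hchain U hU
      have hmem : ∀ {x}, x ∈ sSup c ↔ ∃ V ∈ c, x ∈ V :=
        Subring.mem_sSup_of_directedOn ⟨U, hU⟩ hchain.directedOn
      refine ⟨sSup c, ⟨sSup_le fun V hV => (hc hV).1,
        fun d => hmem.mpr ⟨U, hU, (hc hU).2.1 d⟩, fun h => ?_⟩, fun V hV => le_sSup hV⟩
      obtain ⟨V, hV, h⟩ := hmem.mp h
      exact (hc hV).2.2 h)
    (algebraMap D E).range
    (by
      refine ⟨?_, fun d => ⟨d, rfl⟩, ?_⟩
      · rintro _ ⟨d, rfl⟩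
        exact hD d
      · rintro ⟨d, hd⟩
        refine hp.not_isUnit (IsUnit.of_mul_eq_one d (hinj ?_))
        rw [map_mul, hd, map_one, mul_inv_cancel₀ hp0])
  obtain ⟨⟨hSR, hDS, hpS⟩, hmax⟩ := hS
  -- An element of `R` lies in `S` once its multiple by some `d` coprime to `p` is integral
  -- over `S`: otherwise adjoining it would, by maximality, produce `1 / p`.
  have key : ∀ (d : D) (y : E), IsCoprime d p → y ∈ R → IsIntegral S (algebraMap D E d * y) →
      y ∈ S := by
    intro d y hd hyR hy
    have hle : S ≤ (Algebra.adjoin S {y}).toSubring := fun s hs =>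
      (Algebra.adjoin S {y}).algebraMap_mem ⟨s, hs⟩
    refine hmax (y := (Algebra.adjoin S {y}).toSubring) ⟨?_, fun d => hle (hDS d), fun h => hpS ?_⟩
      hle (Algebra.subset_adjoin rfl)
    · intro z hz
      refine Algebra.adjoin_induction (p := fun z _ => z ∈ R) ?_ ?_ ?_ ?_ hz
      · rintro _ rfl; exact hyR
      · exact fun s => hSR s.2
      · exact fun _ _ _ _ => R.add_mem
      · exact fun _ _ _ _ => R.mul_mem
    · exact Subring.inv_algebraMap_mem_of_mem_adjoin hDS hp0 hd hy h
  refine ⟨S, ⟨lt_of_le_of_ne hSR fun h => hpS (h ▸ hpR), fun U hU hSU => ?_⟩, hDS, fun x hx => ?_,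
    hpS, fun q hq hqR => ?_⟩
  · by_contra hUS
    have hpU : (algebraMap D E p)⁻¹ ∈ U := by
      by_contra hpU
      exact hUS (hmax ⟨hU.le, fun d => hSU (hDS d), hpU⟩ hSU)
    refine hU.not_ge fun x hx => ?_
    -- Write a denominator of `x` as `p ^ n * d'` with `d'` prime to `p`; then
    -- `p ^ n * x` lies in `S`.
    obtain ⟨d, hd0, hd⟩ := (Algebra.IsAlgebraic.isAlgebraic (R := D) x).exists_integral_multiple
    obtain ⟨n, d', hd', rfl⟩ := WfDvdMonoid.max_power_factor hd0 hp.irreducible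
    have hy : algebraMap D E p ^ n * x ∈ S := by
      refine key d' _ ((hp.irreducible.coprime_iff_not_dvd.mpr hd').symm)
        (R.mul_mem (R.pow_mem (hD p) n) hx) ?_
      refine Subring.isIntegral_of_forall_algebraMap_mem hDS ?_
      convert hd using 1
      rw [Algebra.smul_def, map_mul, map_pow]
      ring
    have : x = (algebraMap D E p)⁻¹ ^ n * (algebraMap D E p ^ n * x) := by
      rw [← mul_assoc, ← mul_pow, inv_mul_cancel₀ hp0, one_pow, one_mul]
    rw [this]
    exact U.mul_mem (U.pow_mem hpU n) (hSU hy)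
  · refine key 1 x isCoprime_one_left (hR x ?_) (by simpa using hx)
    obtain ⟨f, hf, h⟩ := hx
    refine ⟨f.map (Subring.inclusion hSR), hf.map _, ?_⟩
    rw [Polynomial.eval₂_map]
    exact h
  · rcases eq_or_ne (algebraMap D E q) 0 with h | h
    · rw [h, inv_zero]; exact S.zero_mem
    · refine key q _ hq hqR ?_
      rw [mul_inv_cancel₀ h]
      exact isIntegral_one

theorem rgMax_infinite_of_isAlgebraic {p : ℕ → D} (hp : ∀ i, Prime (p i))
    (hpp : Pairwise fun i j => IsCoprime (p i) (p j)) : (RgMax E).Infinite := by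
  choose S hS _ _ hpS hqS using fun i => exists_isMaximalSubringOf_inv_notMem (E := E)
    (R := ⊤) (fun _ => Subring.mem_top _) (fun _ _ => Subring.mem_top _) (hp i) (Subring.mem_top _)
  refine Set.infinite_of_injective_forall_mem (f := S) (fun i j hij => ?_) hS
  by_contra hne
  exact hpS i (hij ▸ hqS j (p i) (hpp hne) (Subring.mem_top _))

theorem exists_isInfiniteDescendingChain_of_isAlgebraic {p : ℕ → D} (hp : ∀ i, Prime (p i))
    (hpp : Pairwise fun i j => IsCoprime (p i) (p j)) :
    ∃ R : ℕ → Subring E, IsInfiniteDescendingChain R := by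
  refine exists_isInfiniteDescendingChain_of_step (fun n R => (∀ d : D, algebraMap D E d ∈ R) ∧
    (∀ x, IsIntegral R x → x ∈ R) ∧ ∀ j, n ≤ j → (algebraMap D E (p j))⁻¹ ∈ R)
    ⟨fun _ => Subring.mem_top _, fun _ _ => Subring.mem_top _, fun _ _ => Subring.mem_top _⟩ ?_
  rintro n R ⟨hD, hR, hj⟩
  obtain ⟨S, hS, hDS, hiS, -, hq⟩ :=
    exists_isMaximalSubringOf_inv_notMem hD hR (hp n) (hj n le_rfl)
  exact ⟨S, ⟨hDS, hiS, fun j h => hq _ (hpp (by omega)) (hj j (by omega))⟩, hS⟩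

end Transcendental

open Polynomial in
theorem rgMax_infinite_and_exists_chain_of_not_isAlgebraic {F E : Type*} [Field F] [Field E]
    [Algebra F E] (h : ¬ Algebra.IsAlgebraic F E) :
    (RgMax E).Infinite ∧ ∃ R : ℕ → Subring E, IsInfiniteDescendingChain R := by
  obtain ⟨ι, x, hx⟩ := exists_isTranscendenceBasis' F E
  obtain ⟨i⟩ : Nonempty ι := by
    rw [← not_isEmpty_iff, hx.isEmpty_iff_isAlgebraic]
    exact h
  -- `E` is algebraic over `K[x i]`, where `K` is generated by the other members of the basis.
  let K := IntermediateField.adjoin F (x '' {i}ᶜ)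
  have htr : Transcendental K (x i) :=
    (IntermediateField.transcendental_adjoin_iff).mpr (hx.1.transcendental_adjoin (by simp))
  let := (aeval (R := K) (x i)).toRingHom.toAlgebra
  have hinj : Function.Injective (algebraMap K[X] E) :=
    transcendental_iff_injective.mp htr
  have : FaithfulSMul K[X] E := (faithfulSMul_iff_algebraMap_injective _ _).mpr hinj
  have : Algebra.IsAlgebraic K[X] E := by
    have hle : Algebra.adjoin F (Set.range x) ≤ (aeval (R := K) (x i)).range.restrictScalars F := by
      refine Algebra.adjoin_le ?_
      rintro _ ⟨j, rfl⟩
      rcases eq_or_ne j i with rfl | hj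
      · exact ⟨X, aeval_X _⟩
      · exact ⟨C ⟨x j, IntermediateField.subset_adjoin F _ ⟨j, hj, rfl⟩⟩, aeval_C _ _⟩
    have := hx.isAlgebraic
    have : Algebra.IsAlgebraic (aeval (R := K) (x i)).range E :=
      this.ringHom_of_comp_eq (Subalgebra.inclusion hle).toRingHom (RingHom.id E)
        (Subalgebra.inclusion_injective hle) Function.surjective_id rfl
    exact this.of_ringHom_of_comp_eq (aeval (R := K) (x i)).rangeRestrict (RingHom.id E)
      (aeval (R := K) (x i)).rangeRestrict_surjective Function.injective_id rfl
  obtain ⟨p, hp, hpp⟩ := exists_seq_prime_pairwise_isCoprime (D := K[X]) fun d hd => by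
    have hdeg : (1 + d * X).natDegree ≠ 0 := by
      rw [add_comm, ← C_1, natDegree_add_C, natDegree_mul_X hd]
      exact Nat.succ_ne_zero _
    exact ⟨X, fun h0 => hdeg (by rw [h0, natDegree_zero]),
      fun hu => hdeg (natDegree_eq_zero_of_isUnit hu)⟩
  exact ⟨rgMax_infinite_of_isAlgebraic hp hpp,
    exists_isInfiniteDescendingChain_of_isAlgebraic hp hpp⟩

theorem rgMax_infinite_and_exists_chain_of_not_isAbsolutelyAlgebraic {E : Type*} [Field E]
    (h : ¬ IsAbsolutelyAlgebraic E) :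
    (RgMax E).Infinite ∧ ∃ R : ℕ → Subring E, IsInfiniteDescendingChain R := by
  obtain ⟨q, hq⟩ := CharP.exists E
  rcases CharP.char_is_prime_or_zero E q with hq' | rfl
  · have hF : Fact q.Prime := ⟨hq'⟩
    let := ZMod.algebra E q
    exact rgMax_infinite_and_exists_chain_of_not_isAlgebraic (F := ZMod q)
      fun h' => h ⟨q, hF, _, h'⟩
  · have := CharP.charP_to_charZero E
    by_cases h' : Algebra.IsAlgebraic ℚ E
    · have : Algebra.IsAlgebraic ℤ E := (IsFractionRing.comap_isAlgebraic_iff (K := ℚ)).mpr h'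
      obtain ⟨p, hp, hpp⟩ := exists_seq_prime_pairwise_isCoprime (D := ℤ) fun d hd => by
        have : 0 < d * d := mul_self_pos.mpr hd
        refine ⟨d, by omega, fun hu => ?_⟩
        rcases Int.isUnit_iff.mp hu with h | h <;> omega
      exact ⟨rgMax_infinite_of_isAlgebraic hp hpp,
        exists_isInfiniteDescendingChain_of_isAlgebraic hp hpp⟩
    · exact rgMax_infinite_and_exists_chain_of_not_isAlgebraic h'

/-! ### Absolute degrees and subrings of absolutely algebraic fields -/

section AbsoluteDegree

variable {E : Type*} [Field E] (q : ℕ) [Fact q.Prime] [Algebra (ZMod q) E]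

/-- The absolute degree of `x`: its degree over the prime field, equivalently the `n` such that `x`
generates the field with `q ^ n` elements. -/
noncomputable def absDegree (x : E) : ℕ := (minpoly (ZMod q) x).natDegree

/-- The divisors of the absolute degrees of the elements of `S`. By `mem_absDegrees_iff` each of
them is itself such a degree, so these are the `n` for which `S` contains the field with `q ^ n`
elements. -/
def absDegrees (S : Subring E) : Set ℕ := {n | ∃ x ∈ S, n ∣ absDegree q x}

variable {q}

theorem mem_absDegrees_of_dvd {S : Subring E} {m n : ℕ} (hn : n ∈ absDegrees q S) (h : m ∣ n) :
    m ∈ absDegrees q S := by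
  obtain ⟨x, hx, hxn⟩ := hn
  exact ⟨x, hx, h.trans hxn⟩

theorem one_mem_absDegrees (S : Subring E) : 1 ∈ absDegrees q S := ⟨1, S.one_mem, one_dvd _⟩

variable [Algebra.IsAlgebraic (ZMod q) E]

variable (q)

theorem absDegree_pos (x : E) : 0 < absDegree q x :=
  minpoly.natDegree_pos (Algebra.IsIntegral.isIntegral x)

theorem absDegree_dvd_iff {x : E} {n : ℕ} : absDegree q x ∣ n ↔ x ^ q ^ n = x := by
  have h := (minpoly.irreducible (Algebra.IsIntegral.isIntegral (R := ZMod q) x)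
    ).natDegree_dvd_iff_dvd_X_pow_card_pow_sub_X (n := n)
  rw [absDegree, h, minpoly.dvd_iff, Nat.card_zmod]
  simp [sub_eq_zero]

variable {q}

theorem Subfield.mem_iff_absDegree_dvd {K : Subfield E} {n : ℕ} (hn : n ≠ 0)
    (hK : Nat.card K = q ^ n) {x : E} : x ∈ K ↔ absDegree q x ∣ n := by
  have hq := (Fact.out : q.Prime)
  have : Finite K := Nat.finite_of_card_ne_zero (hK ▸ (pow_pos hq.pos n).ne')
  have := Fintype.ofFinite K
  have hcard : Fintype.card K = q ^ n := by rw [← Nat.card_eq_fintype_card, hK]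
  have hpow : ∀ y ∈ K, y ^ q ^ n = y := fun y hy => by
    simpa [hcard] using congrArg Subtype.val (FiniteField.pow_card (⟨y, hy⟩ : K))
  rw [absDegree_dvd_iff]
  refine ⟨hpow x, fun hx => ?_⟩
  -- The elements of `K` already exhaust the roots of `X ^ q ^ n - X`.
  classical
  set f : Polynomial E := Polynomial.X ^ q ^ n - Polynomial.X
  have hf0 : f ≠ 0 := FiniteField.X_pow_card_pow_sub_X_ne_zero E hn hq.one_lt
  have hsub : (K : Set E).toFinset ⊆ f.roots.toFinset := fun y hy => by
    have := hpow y (by simpa using hy)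
    simp [Polynomial.mem_roots hf0, f, this]
  have heq := Finset.eq_of_subset_of_card_le hsub <| by
    refine (Multiset.toFinset_card_le _).trans (f.card_roots'.trans ?_)
    rw [FiniteField.X_pow_card_pow_sub_X_natDegree_eq E hn hq.one_lt, Set.toFinset_card]
    exact hcard.ge
  have : x ∈ (K : Set E).toFinset := by
    rw [heq]
    simp [Polynomial.mem_roots hf0, f, hx]
  simpa using this

theorem Subfield.exists_absDegree_eq {K : Subfield E} {n d : ℕ} (hn : n ≠ 0)
    (hK : Nat.card K = q ^ n) (hd : d ∣ n) : ∃ x ∈ K, absDegree q x = d := by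
  have hq := (Fact.out : q.Prime)
  have : Finite K := Nat.finite_of_card_ne_zero (hK ▸ (pow_pos hq.pos n).ne')
  have hd0 : d ≠ 0 := by rintro rfl; exact hn (zero_dvd_iff.mp hd)
  obtain ⟨g, hg⟩ := IsCyclic.exists_ofOrder_eq_natCard (α := Kˣ)
  have hg' : orderOf g = q ^ n - 1 := by rw [hg, Nat.card_units, hK]
  have hdvd : q ^ d - 1 ∣ orderOf g := hg' ▸ Nat.pow_sub_one_dvd_pow_sub_one q hd
  have hg0 : orderOf g ≠ 0 := (orderOf_pos g).ne'
  -- The element of order `q ^ d - 1` in the cyclic group of units has degree `d`.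
  set u := g ^ (orderOf g / (q ^ d - 1)) with hu
  have hou : orderOf u = q ^ d - 1 := orderOf_pow_orderOf_div hg0 hdvd
  have hiff : ∀ m : ℕ, ((u : K) : E) ^ q ^ m = ((u : K) : E) ↔ q ^ d - 1 ∣ q ^ m - 1 := by
    intro m
    rw [← hou, orderOf_dvd_iff_pow_eq_one]
    have : q ^ m = q ^ m - 1 + 1 := (Nat.sub_add_cancel (pow_pos hq.pos m)).symm
    rw [← SubmonoidClass.coe_pow, ← Units.val_pow_eq_pow_val, Subtype.coe_inj, Units.val_inj]
    conv_lhs => rw [this, pow_succ]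
    rw [mul_eq_right]
  refine ⟨(u : K), (u : K).2, le_antisymm (Nat.le_of_dvd (Nat.pos_of_ne_zero hd0) ?_) ?_⟩
  · rw [absDegree_dvd_iff, hiff]
  · have h := (hiff _).mp ((absDegree_dvd_iff q).mp dvd_rfl)
    have h1 := Nat.one_lt_pow (absDegree_pos q ((u : K) : E)).ne' hq.one_lt
    have h2 := Nat.le_of_dvd (by omega) h
    exact (Nat.pow_le_pow_iff_right hq.one_lt).mp (by omega)

theorem exists_subfield_natCard_of_finite {s : Set E} (hs : s.Finite) :
    ∃ (K : Subfield E) (n : ℕ), n ≠ 0 ∧ Nat.card K = q ^ n ∧ s ⊆ K ∧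
      ∀ S : Subring E, s ⊆ S → K.toSubring ≤ S := by
  let K := IntermediateField.adjoin (ZMod q) s
  have : Finite s := hs
  have : FiniteDimensional (ZMod q) K :=
    IntermediateField.finiteDimensional_adjoin fun x _ => Algebra.IsIntegral.isIntegral x
  refine ⟨K.toSubfield, Module.finrank (ZMod q) K, Module.finrank_pos.ne', ?_,
    IntermediateField.subset_adjoin _ _, fun S hS x hx => ?_⟩
  · have := Module.natCard_eq_pow_finrank (K := ZMod q) (V := K)
    rwa [Nat.card_zmod] at this
  · have hx' : x ∈ Algebra.adjoin (ZMod q) s := by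
      rw [← IntermediateField.adjoin_toSubalgebra_of_isAlgebraic
        fun x _ => Algebra.IsAlgebraic.isAlgebraic x]
      exact hx
    refine Algebra.adjoin_induction (p := fun z _ => z ∈ S) (fun _ h => hS h) (fun r => ?_)
      (fun _ _ _ _ => S.add_mem) (fun _ _ _ _ => S.mul_mem) hx'
    obtain ⟨m, rfl⟩ := ZMod.intCast_surjective r
    rw [map_intCast]
    exact intCast_mem S m

theorem ne_zero_of_mem_absDegrees {S : Subring E} {n : ℕ} (hn : n ∈ absDegrees q S) : n ≠ 0 := by
  rintro rfl
  obtain ⟨x, -, hx⟩ := hn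
  exact (absDegree_pos q x).ne' (zero_dvd_iff.mp hx)

theorem mem_absDegrees_iff {S : Subring E} {n : ℕ} :
    n ∈ absDegrees q S ↔ ∃ x ∈ S, absDegree q x = n := by
  refine ⟨?_, fun ⟨x, hx, h⟩ => ⟨x, hx, h.symm.dvd⟩⟩
  rintro ⟨x, hx, hxn⟩
  obtain ⟨K, m, hm, hK, hxK, hKS⟩ := exists_subfield_natCard_of_finite (q := q)
    (Set.finite_singleton x)
  obtain ⟨z, hz, hzn⟩ := Subfield.exists_absDegree_eq hm hK
    (hxn.trans ((Subfield.mem_iff_absDegree_dvd hm hK).mp (hxK rfl)))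
  exact ⟨z, hKS S (by simpa using hx) hz, hzn⟩

/-- The subfield generated by `x` has `q ^ absDegree q x` elements and lies in every subring
containing `x`. -/
theorem exists_subfield_natCard {x : E} : ∃ K : Subfield E, Nat.card K = q ^ absDegree q x ∧
    x ∈ K ∧ ∀ S : Subring E, x ∈ S → K.toSubring ≤ S := by
  obtain ⟨K, m, hm, hK, hxK, hKS⟩ := exists_subfield_natCard_of_finite (q := q)
    (Set.finite_singleton x)
  refine ⟨K, ?_, hxK rfl, fun S hS => hKS S (by simpa using hS)⟩
  have h1 := (Subfield.mem_iff_absDegree_dvd hm hK).mp (hxK rfl)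
  -- A generator of `K` lies in the subring of fixed points of the corresponding Frobenius power.
  obtain ⟨z, hz, hzm⟩ := Subfield.exists_absDegree_eq hm hK dvd_rfl
  have : CharP E q := charP_of_injective_algebraMap (algebraMap (ZMod q) E).injective q
  have hzx := hKS (RingHom.eqLocus (iterateFrobenius E q (absDegree q x)) (RingHom.id E))
    (by
      rintro _ rfl
      exact (absDegree_dvd_iff q).mp dvd_rfl) hz
  have h2 := (absDegree_dvd_iff q).mpr hzx
  rw [hzm] at h2
  rw [hK, Nat.dvd_antisymm h1 h2]

theorem mem_iff_absDegree_mem {S : Subring E} {x : E} : x ∈ S ↔ absDegree q x ∈ absDegrees q S := by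
  refine ⟨fun hx => ⟨x, hx, dvd_rfl⟩, fun ⟨y, hy, hxy⟩ => ?_⟩
  obtain ⟨K, hK, -, hKS⟩ := exists_subfield_natCard (q := q) (x := y)
  exact hKS S hy ((Subfield.mem_iff_absDegree_dvd (absDegree_pos q y).ne' hK).mpr hxy)

theorem exists_mem_absDegrees_dvd_dvd {S : Subring E} {m n : ℕ} (hm : m ∈ absDegrees q S)
    (hn : n ∈ absDegrees q S) : ∃ k ∈ absDegrees q S, m ∣ k ∧ n ∣ k := by
  obtain ⟨x, hx, hxm⟩ := hm
  obtain ⟨y, hy, hyn⟩ := hn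
  obtain ⟨K, k, hk, hK, hxK, hKS⟩ := exists_subfield_natCard_of_finite (q := q)
    (Set.toFinite {x, y})
  obtain ⟨z, hz, hzk⟩ := Subfield.exists_absDegree_eq hk hK dvd_rfl
  refine ⟨k, mem_absDegrees_iff.mpr ⟨z, hKS S ?_ hz, hzk⟩,
    hxm.trans ((Subfield.mem_iff_absDegree_dvd hk hK).mp (hxK (by simp))),
    hyn.trans ((Subfield.mem_iff_absDegree_dvd hk hK).mp (hxK (by simp)))⟩
  rintro _ (rfl | rfl) <;> assumption

theorem mem_absDegrees_of_prime_pow {S : Subring E} {n : ℕ} (hn : n ≠ 0)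
    (h : ∀ p k : ℕ, p.Prime → p ^ k ∣ n → p ^ k ∈ absDegrees q S) : n ∈ absDegrees q S := by
  induction n using Nat.recOnPosPrimePosCoprime with
  | prime_pow p k hp _ => exact h p k hp dvd_rfl
  | zero => exact absurd rfl hn
  | one => exact one_mem_absDegrees S
  | coprime a b ha hb hab iha ihb =>
    obtain ⟨k, hk, hak, hbk⟩ := exists_mem_absDegrees_dvd_dvd
      (iha (by omega) fun p k hp hpk => h p k hp (hpk.mul_right b))
      (ihb (by omega) fun p k hp hpk => h p k hp (hpk.mul_left a))
    exact mem_absDegrees_of_dvd hk (hab.mul_dvd_of_dvd_of_dvd hak hbk)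

/-- Subrings are compared through the prime powers among the degrees of their elements. The case
`k = 0` carries no information, whence the exponents `k + 1`. -/
theorem subring_le_of_prime_pow {R S : Subring E} (h : ∀ p k : ℕ, p.Prime →
    p ^ (k + 1) ∈ absDegrees q R → p ^ (k + 1) ∈ absDegrees q S) : R ≤ S := by
  intro x hx
  rw [mem_iff_absDegree_mem (q := q)] at hx ⊢
  refine mem_absDegrees_of_prime_pow (absDegree_pos q x).ne' fun p k hp hpk => ?_
  cases k with
  | zero => rw [pow_zero]; exact one_mem_absDegrees S
  | succ k => exact h p k hp (mem_absDegrees_of_dvd hx hpk)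

variable (q) in
/-- The elements of `R` whose absolute degree is not divisible by `p ^ (k + 1)`. The exponent is
positive because `p ^ 0` divides every degree. -/
def Subring.primePowFree (R : Subring E) {p : ℕ} (hp : p.Prime) (k : ℕ) : Subring E :=
  have : CharP E q := charP_of_injective_algebraMap (algebraMap (ZMod q) E).injective q
  -- If every Frobenius power fixing `x` and `y` also fixes `z`, the degree of `z` divides the least
  -- common multiple of those of `x` and `y`, and a prime power dividing the latter divides one of the two.
  have key : ∀ x y z : E, ¬ p ^ (k + 1) ∣ absDegree q x → ¬ p ^ (k + 1) ∣ absDegree q y →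
      (∀ n, x ^ q ^ n = x → y ^ q ^ n = y → z ^ q ^ n = z) → ¬ p ^ (k + 1) ∣ absDegree q z := by
    intro x y z hx hy h hz
    have h1 : absDegree q z ∣ (absDegree q x).lcm (absDegree q y) :=
      (absDegree_dvd_iff q).mpr (h _ ((absDegree_dvd_iff q).mp (Nat.dvd_lcm_left _ _))
        ((absDegree_dvd_iff q).mp (Nat.dvd_lcm_right _ _)))
    have h2 := hz.trans h1
    have hx0 := (absDegree_pos q x).ne'
    have hy0 := (absDegree_pos q y).ne'
    rw [hp.pow_dvd_iff_le_factorization (Nat.lcm_ne_zero hx0 hy0),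
      Nat.factorization_lcm hx0 hy0, Finsupp.sup_apply, le_sup_iff,
      ← hp.pow_dvd_iff_le_factorization hx0, ← hp.pow_dvd_iff_le_factorization hy0] at h2
    exact h2.elim hx hy
  have key1 : ∀ z : E, (∀ n, z ^ q ^ n = z) → ¬ p ^ (k + 1) ∣ absDegree q z := by
    intro z hz hd
    have h1 : absDegree q z ∣ 1 := (absDegree_dvd_iff q).mpr (hz 1)
    exact hp.one_lt.ne' (Nat.dvd_one.mp ((dvd_pow_self p k.succ_ne_zero).trans (hd.trans h1)))
  { carrier := {x | x ∈ R ∧ ¬ p ^ (k + 1) ∣ absDegree q x}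
    zero_mem' := ⟨R.zero_mem, key1 0 fun n =>
      zero_pow (pow_pos (Fact.out : q.Prime).pos n).ne'⟩
    one_mem' := ⟨R.one_mem, key1 1 fun n => one_pow _⟩
    add_mem' := fun {x y} hx hy => ⟨R.add_mem hx.1 hy.1, key x y _ hx.2 hy.2 fun n h1 h2 => by
      rw [add_pow_char_pow, h1, h2]⟩
    mul_mem' := fun {x y} hx hy => ⟨R.mul_mem hx.1 hy.1, key x y _ hx.2 hy.2 fun n h1 h2 => by
      rw [mul_pow, h1, h2]⟩
    neg_mem' := fun {x} hx => ⟨R.neg_mem hx.1, key x x _ hx.2 hx.2 fun n h1 _ => by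
      have := map_neg (iterateFrobenius E q n) x
      simpa [iterateFrobenius_def, h1] using this⟩ }

theorem mem_absDegrees_primePowFree {R : Subring E} {p : ℕ} (hp : p.Prime) {k n : ℕ} :
    n ∈ absDegrees q (R.primePowFree q hp k) ↔ n ∈ absDegrees q R ∧ ¬ p ^ (k + 1) ∣ n := by
  constructor
  · rintro ⟨x, hx, hxn⟩
    exact ⟨⟨x, hx.1, hxn⟩, fun h => hx.2 (h.trans hxn)⟩
  · rintro ⟨hn, hpn⟩
    obtain ⟨x, hx, rfl⟩ := mem_absDegrees_iff.mp hn
    exact ⟨x, ⟨hx, hpn⟩, dvd_rfl⟩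

theorem primePow_dvd_primePow_iff {p l : ℕ} (hp : p.Prime) (hl : l.Prime) {k j : ℕ} :
    p ^ (k + 1) ∣ l ^ (j + 1) ↔ p = l ∧ k ≤ j := by
  constructor
  · intro h
    have : p = l := (Nat.prime_dvd_prime_iff_eq hp hl).mp
      (hp.dvd_of_dvd_pow ((dvd_pow_self p k.succ_ne_zero).trans h))
    subst this
    exact ⟨rfl, by have := (Nat.pow_dvd_pow_iff_le_right hp.one_lt).mp h; omega⟩
  · rintro ⟨rfl, h⟩
    exact pow_dvd_pow _ (by omega)

/-- The maximal subrings of `R` arise by lowering the exponent of one prime, occurring in the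
Steinitz number of `R` with finite exponent, by one. -/
theorem isMaximalSubringOf_iff {R S : Subring E} : IsMaximalSubringOf S R ↔
    ∃ (p : ℕ) (hp : p.Prime) (k : ℕ), p ^ (k + 1) ∈ absDegrees q R ∧
      p ^ (k + 2) ∉ absDegrees q R ∧ S = R.primePowFree q hp k := by
  have hlt : ∀ {p : ℕ} (hp : p.Prime) {k : ℕ}, p ^ (k + 1) ∈ absDegrees q R →
      R.primePowFree q hp k < R := by
    intro p hp k hk
    refine lt_of_le_of_ne (fun x hx => hx.1) fun h => ?_
    rw [← h, mem_absDegrees_primePowFree] at hk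
    exact hk.2 dvd_rfl
  constructor
  · intro hS
    obtain ⟨p, k, hp, hkR, hkS⟩ : ∃ p k : ℕ, p.Prime ∧ p ^ (k + 1) ∈ absDegrees q R ∧
        p ^ (k + 1) ∉ absDegrees q S := by
      by_contra! h
      exact hS.1.not_ge (subring_le_of_prime_pow h)
    have hle : ∀ j, k ≤ j → S ≤ R.primePowFree q hp j := fun j hj x hx =>
      ⟨hS.1.le hx, fun h => hkS ⟨x, hx, (pow_dvd_pow p (by omega)).trans h⟩⟩
    refine ⟨p, hp, k, hkR, fun hk' => ?_,
      le_antisymm (hle k le_rfl) (hS.2 (hlt hp hkR) (hle k le_rfl))⟩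
    -- Otherwise `S` would lie properly below the proper subring excluding `p ^ (k + 2)`.
    refine hkS ?_
    rw [le_antisymm (hle (k + 1) (by omega)) (hS.2 (hlt hp hk') (hle (k + 1) (by omega))),
      mem_absDegrees_primePowFree]
    exact ⟨hkR, fun h => by
      have := ((primePow_dvd_primePow_iff hp hp).mp h).2
      omega⟩
  · rintro ⟨p, hp, k, hk, hk', rfl⟩
    refine ⟨hlt hp hk, fun U hU hSU => ?_⟩
    by_contra hUS
    obtain ⟨x, hxU, hx⟩ := Set.not_subset.mp hUS
    have hpU : p ^ (k + 1) ∈ absDegrees q U := ⟨x, hxU, by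
      by_contra h
      exact hx ⟨hU.le hxU, h⟩⟩
    refine hU.not_ge (subring_le_of_prime_pow (q := q) fun l j hl hj => ?_)
    -- The only prime powers of `R` missing from the subring are those from `p ^ (k + 1)` on, and
    -- this one is the last of them.
    by_cases h : p = l ∧ k ≤ j
    · obtain ⟨rfl, h⟩ := h
      have : j = k := by
        by_contra hne
        exact hk' (mem_absDegrees_of_dvd hj (pow_dvd_pow p (by omega)))
      rwa [this]
    · obtain ⟨y, hy, hyj⟩ := mem_absDegrees_primePowFree hp |>.mpr
        ⟨hj, (primePow_dvd_primePow_iff hp hl).not.mpr h⟩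
      exact ⟨y, hSU hy, hyj⟩

theorem FG_eq_absDegrees : FG E = absDegrees q (⊤ : Subring E) := by
  have : CharP E q := charP_of_injective_algebraMap (algebraMap (ZMod q) E).injective q
  have hq : ringChar E = q := ringChar.eq E q
  ext n
  rw [FG, Set.mem_ofPred_eq, hq, mem_absDegrees_iff]
  constructor
  · rintro ⟨hn, K, hK⟩
    obtain ⟨x, -, hx⟩ := Subfield.exists_absDegree_eq hn.ne' hK dvd_rfl
    exact ⟨x, Subring.mem_top x, hx⟩
  · rintro ⟨x, -, rfl⟩
    obtain ⟨K, hK, -⟩ := exists_subfield_natCard (q := q) (x := x)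
    exact ⟨absDegree_pos q x, K, hK⟩

end AbsoluteDegree

/-! ### Exponents along descending chains -/

section Levels

variable {E : Type*} [Field E] (q : ℕ) [Fact q.Prime] [Algebra (ZMod q) E]

/-- The `k` such that `S` has elements of absolute degree divisible by `p ^ (k + 1)`. For prime `p`
this is an initial segment of `ℕ` whose length is the exponent of `p` in the Steinitz number
of `S`. -/
def levels (S : Subring E) (p : ℕ) : Set ℕ := {k | p ^ (k + 1) ∈ absDegrees q S}

variable {q}

theorem levels_eq_Iio {S : Subring E} {p k : ℕ} (hk : p ^ (k + 1) ∈ absDegrees q S)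
    (hk' : p ^ (k + 2) ∉ absDegrees q S) : levels q S p = Set.Iio (k + 1) := by
  ext j
  refine ⟨fun hj => ?_, fun hj => ?_⟩
  · by_contra h
    rw [Set.mem_Iio, not_lt] at h
    exact hk' (mem_absDegrees_of_dvd hj (pow_dvd_pow p (by omega)))
  · exact mem_absDegrees_of_dvd hk (pow_dvd_pow p (by have := Set.mem_Iio.mp hj; omega))

theorem exists_of_levels_finite {S : Subring E} {p : ℕ} (hne : (levels q S p).Nonempty)
    (hf : (levels q S p).Finite) :
    ∃ k, p ^ (k + 1) ∈ absDegrees q S ∧ p ^ (k + 2) ∉ absDegrees q S := by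
  by_contra! h
  obtain ⟨j, hj⟩ := hne
  have hall : ∀ i, j + i ∈ levels q S p := fun i => by
    induction i with
    | zero => exact hj
    | succ i ih => exact h (j + i) ih
  exact Set.infinite_of_injective_forall_mem (add_right_injective j) hall hf

theorem levels_eq_univ {S : Subring E} {p : ℕ} (h : ¬ (levels q S p).Finite) :
    levels q S p = Set.univ := by
  refine Set.eq_univ_of_forall fun k => ?_
  obtain ⟨j, hj, hkj⟩ := Set.Infinite.exists_gt h k
  exact mem_absDegrees_of_dvd hj (pow_dvd_pow p (by omega))

variable [Algebra.IsAlgebraic (ZMod q) E]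

theorem levels_primePowFree_self {R : Subring E} {p : ℕ} (hp : p.Prime) {k : ℕ}
    (hk : p ^ (k + 1) ∈ absDegrees q R) :
    levels q (R.primePowFree q hp k) p = Set.Iio k := by
  ext j
  rw [levels, Set.mem_ofPred_eq, mem_absDegrees_primePowFree, primePow_dvd_primePow_iff hp hp,
    Set.mem_Iio]
  refine ⟨fun h => not_le.mp fun h' => h.2 ⟨rfl, h'⟩, fun h => ⟨?_, fun h' => h.not_ge h'.2⟩⟩
  exact mem_absDegrees_of_dvd hk (pow_dvd_pow p (by omega))

theorem levels_primePowFree_of_ne {R : Subring E} {p l : ℕ} (hp : p.Prime) (hl : l.Prime)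
    (hne : p ≠ l) {k : ℕ} : levels q (R.primePowFree q hp k) l = levels q R l := by
  ext j
  rw [levels, Set.mem_ofPred_eq, mem_absDegrees_primePowFree, primePow_dvd_primePow_iff hp hl]
  exact and_iff_left fun h => hne h.1

theorem mem_finitePart_iff {p : ℕ} : p ∈ finitePart (FG E) ↔
    p.Prime ∧ (levels q (⊤ : Subring E) p).Nonempty ∧ (levels q (⊤ : Subring E) p).Finite := by
  rw [finitePart, Set.mem_ofPred_eq, FG_eq_absDegrees (q := q)]
  refine and_congr_right fun hp => ⟨?_, fun ⟨hne, hf⟩ => ?_⟩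
  · rintro ⟨n, hn, hpn, hpn'⟩
    obtain ⟨k, rfl⟩ := Nat.exists_eq_succ_of_ne_zero hn.ne'
    exact ⟨⟨k, hpn⟩, levels_eq_Iio hpn hpn' ▸ Set.finite_Iio _⟩
  · obtain ⟨k, hk, hk'⟩ := exists_of_levels_finite hne hf
    exact ⟨k + 1, k.succ_pos, hk, hk'⟩

theorem mem_infinitePart_iff {p : ℕ} : p ∈ infinitePart (FG E) ↔
    p.Prime ∧ ¬ (levels q (⊤ : Subring E) p).Finite := by
  rw [infinitePart, Set.mem_ofPred_eq, FG_eq_absDegrees (q := q)]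
  refine and_congr_right fun hp => ⟨fun h => ?_, fun h n hn => ?_⟩
  · have : levels q (⊤ : Subring E) p = Set.univ :=
      Set.eq_univ_of_forall fun k => h (k + 1) k.succ_pos
    rw [this]
    exact Set.infinite_univ
  · obtain ⟨k, rfl⟩ := Nat.exists_eq_succ_of_ne_zero hn.ne'
    exact (levels_eq_univ h).ge (Set.mem_univ k)

theorem fgOrder_eq_ncard_levels {p : ℕ} (hp : p ∈ finitePart (FG E)) :
    fgOrder (FG E) p = (levels q (⊤ : Subring E) p).ncard := by
  obtain ⟨-, hne, hf⟩ := (mem_finitePart_iff (q := q)).mp hp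
  obtain ⟨k, hk, hk'⟩ := exists_of_levels_finite hne hf
  have hlev := levels_eq_Iio hk hk'
  have hset : {n : ℕ | 0 < n ∧ p ^ n ∈ FG E ∧ p ^ (n + 1) ∉ FG E} = {k + 1} := by
    ext n
    rw [FG_eq_absDegrees (q := q), Set.mem_singleton_iff]
    refine ⟨fun ⟨hn, hpn, hpn'⟩ => ?_, fun h => h ▸ ⟨k.succ_pos, hk, hk'⟩⟩
    obtain ⟨j, rfl⟩ := Nat.exists_eq_succ_of_ne_zero hn.ne'
    have := (levels_eq_Iio hpn hpn').symm.trans hlev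
    exact Set.Iio_injective this
  have hg : ∃ n : ℕ, IsGreatest {n : ℕ | 0 < n ∧ p ^ n ∈ FG E ∧ p ^ (n + 1) ∉ FG E} n :=
    ⟨k + 1, hset ▸ isGreatest_singleton⟩
  have hc : hg.choose = k + 1 := by
    exact hset.le hg.choose_spec.1
  rw [fgOrder, dif_pos hg, hc, hlev, Set.ncard_Iio_nat]

/-- If every prime occurs in `R` with finite exponent as soon as it does in `E`, the same holds for
a maximal subring `S` of `R`, and the exponents in `S` of the primes of finite exponent in `E` add
up to one less than those in `R`. -/
theorem IsMaximalSubringOf.sum_ncard_levels {R S : Subring E} (h : IsMaximalSubringOf S R)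
    (hR : ∀ p : ℕ, p.Prime → ((levels q R p).Finite ↔ (levels q (⊤ : Subring E) p).Finite))
    (hf : (finitePart (FG E)).Finite) :
    (∀ p : ℕ, p.Prime → ((levels q S p).Finite ↔ (levels q (⊤ : Subring E) p).Finite)) ∧
      ∑ p ∈ hf.toFinset, (levels q S p).ncard + 1 = ∑ p ∈ hf.toFinset, (levels q R p).ncard := by
  obtain ⟨p, hp, k, hk, hk', rfl⟩ := (isMaximalSubringOf_iff (q := q)).mp h
  have hRp := levels_eq_Iio hk hk'
  have hfin : (levels q R p).Finite := hRp ▸ Set.finite_Iio _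
  have hpT : p ∈ hf.toFinset := by
    rw [Set.Finite.mem_toFinset, mem_finitePart_iff (q := q)]
    obtain ⟨x, -, hx⟩ := hk
    exact ⟨hp, ⟨k, x, Subring.mem_top x, hx⟩, (hR p hp).mp hfin⟩
  refine ⟨fun l hl => ?_, ?_⟩
  · rw [← hR l hl]
    rcases eq_or_ne p l with rfl | hne
    · rw [levels_primePowFree_self hp hk]
      exact iff_of_true (Set.finite_Iio _) hfin
    · rw [levels_primePowFree_of_ne hp hl hne]
  · rw [← Finset.add_sum_erase _ _ hpT, ← Finset.add_sum_erase _ _ hpT,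
      levels_primePowFree_self hp hk, hRp, Set.ncard_Iio_nat, Set.ncard_Iio_nat,
      Finset.sum_congr rfl fun l hl => ?_]
    · rw [add_right_comm]
    · have hl' := Finset.mem_erase.mp hl
      rw [levels_primePowFree_of_ne hp ((Set.Finite.mem_toFinset hf).mp hl'.2).1 hl'.1.symm]

theorem finite_setOf_isMaximalSubringOf {R : Subring E}
    (hR : ∀ p : ℕ, p.Prime → ((levels q R p).Finite ↔ (levels q (⊤ : Subring E) p).Finite))
    (hf : (finitePart (FG E)).Finite) : {S | IsMaximalSubringOf S R}.Finite := by
  refine (hf.biUnion (t := fun p => {S | ∃ (hp : p.Prime) (k : ℕ), p ^ (k + 1) ∈ absDegrees q R ∧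
    p ^ (k + 2) ∉ absDegrees q R ∧ S = R.primePowFree q hp k}) fun p _ =>
      Set.Subsingleton.finite ?_).subset fun S hS => ?_
  · rintro _ ⟨_, k, hk, hk', rfl⟩ _ ⟨_, j, hj, hj', rfl⟩
    have := Set.Iio_injective ((levels_eq_Iio hk hk').symm.trans (levels_eq_Iio hj hj'))
    obtain rfl : k = j := by omega
    rfl
  · obtain ⟨p, hp, k, hk, hk', rfl⟩ := (isMaximalSubringOf_iff (q := q)).mp hS
    refine Set.mem_biUnion (x := p) ((mem_finitePart_iff (q := q)).mpr ⟨hp, ?_, ?_⟩)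
      ⟨hp, k, hk, hk', rfl⟩
    · obtain ⟨x, -, hx⟩ := hk
      exact ⟨k, x, Subring.mem_top x, hx⟩
    · exact (hR p hp).mp (levels_eq_Iio hk hk' ▸ Set.finite_Iio _)

variable (q) in
include q in
theorem rgMax_finite_iff : (RgMax E).Finite ↔ (finitePart (FG E)).Finite := by
  refine ⟨fun h => ?_, finite_setOf_isMaximalSubringOf (q := q) fun _ _ => Iff.rfl⟩
  choose! k hk hk' using fun p (hp : p ∈ finitePart (FG E)) =>
    let h := (mem_finitePart_iff (q := q)).mp hp
    exists_of_levels_finite h.2.1 h.2.2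
  have := h.to_subtype
  refine Set.finite_coe_iff.mp (Finite.of_injective (β := RgMax E) (fun p : finitePart (FG E) =>
    ⟨(⊤ : Subring E).primePowFree q p.2.1 (k p), isMaximalSubringOf_iff.mpr
      ⟨p, p.2.1, k p, hk p p.2, hk' p p.2, rfl⟩⟩) fun p l hpl => ?_)
  by_contra hne
  have h1 := hk p p.2
  have h2 : (p : ℕ) ^ (k p + 1) ∉ absDegrees q ((⊤ : Subring E).primePowFree q p.2.1 (k p)) :=
    fun h => (mem_absDegrees_primePowFree _).mp h |>.2 dvd_rfl
  rw [Subtype.mk.inj hpl, mem_absDegrees_primePowFree, primePow_dvd_primePow_iff l.2.1 p.2.1] at h2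
  exact h2 ⟨h1, fun h => hne (Subtype.ext h.1.symm)⟩

variable (q) in
include q in
theorem exists_isInfiniteDescendingChain_of_infinite (h : (finitePart (FG E)).Infinite) :
    ∃ R : ℕ → Subring E, IsInfiniteDescendingChain R := by
  let e := h.natEmbedding
  refine exists_isInfiniteDescendingChain_of_step
    (fun n R => ∀ j, n ≤ j → levels q R (e j) = levels q ⊤ (e j)) (fun _ _ => rfl) ?_
  intro n R hR
  obtain ⟨hp, hne, hfin⟩ := (mem_finitePart_iff (q := q)).mp (e n).2
  rw [← hR n le_rfl] at hne hfin
  obtain ⟨k, hk, hk'⟩ := exists_of_levels_finite hne hfin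
  refine ⟨R.primePowFree q hp k, fun j hj => ?_,
    isMaximalSubringOf_iff.mpr ⟨e n, hp, k, hk, hk', rfl⟩⟩
  rw [levels_primePowFree_of_ne hp (e j).2.1, hR j (by omega)]
  intro h
  have := e.injective (Subtype.ext h)
  omega

theorem sum_ncard_levels_add_of_chain (hf : (finitePart (FG E)).Finite) {n : ℕ}
    {R : ℕ → Subring E} (h0 : R 0 = ⊤) (hR : ∀ i < n, IsMaximalSubringOf (R (i + 1)) (R i)) :
    (∀ p : ℕ, p.Prime → ((levels q (R n) p).Finite ↔ (levels q (⊤ : Subring E) p).Finite)) ∧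
      ∑ p ∈ hf.toFinset, (levels q (R n) p).ncard + n =
        ∑ p ∈ hf.toFinset, (levels q (⊤ : Subring E) p).ncard := by
  induction n with
  | zero => rw [h0]; exact ⟨fun _ _ => Iff.rfl, rfl⟩
  | succ n ih =>
    obtain ⟨h1, h2⟩ := ih fun i hi => hR i (by omega)
    obtain ⟨h3, h4⟩ := (hR n (by omega)).sum_ncard_levels h1 hf
    exact ⟨h3, by omega⟩

theorem IsDescendingChain.sum_ncard_levels_add_length (hf : (finitePart (FG E)).Finite)
    {c : RelSeries (maximalSubringRel E)} (hc : IsDescendingChain c) :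
    (∀ p : ℕ, p.Prime → ((levels q c.last p).Finite ↔ (levels q (⊤ : Subring E) p).Finite)) ∧
      ∑ p ∈ hf.toFinset, (levels q c.last p).ncard + c.length =
        ∑ p ∈ hf.toFinset, (levels q (⊤ : Subring E) p).ncard := by
  have := sum_ncard_levels_add_of_chain (q := q) hf (n := c.length)
    (R := fun i => c (Fin.ofNat _ i)) (hc : c 0 = ⊤) fun i hi => by
      have := c.step ⟨i, hi⟩
      have h1 : Fin.ofNat (c.length + 1) i = (⟨i, hi⟩ : Fin c.length).castSucc := by
        ext; simp; omega
      have h2 : Fin.ofNat (c.length + 1) (i + 1) = (⟨i, hi⟩ : Fin c.length).succ := by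
        ext; simp; omega
      rw [h1, h2]
      exact this
  have hlast : c (Fin.ofNat _ c.length) = c.last := by
    congr 1; ext; simp
  simpa only [hlast] using this

variable (q) in
include q in
theorem not_exists_isInfiniteDescendingChain (hf : (finitePart (FG E)).Finite) :
    ¬ ∃ R : ℕ → Subring E, IsInfiniteDescendingChain R := by
  rintro ⟨R, h0, hR⟩
  have := (sum_ncard_levels_add_of_chain (q := q) hf h0
    (n := ∑ p ∈ hf.toFinset, (levels q (⊤ : Subring E) p).ncard + 1) fun i _ => hR i).2
  omega

/-- A complete chain ends when all exponents are zero or infinite; the infinite ones are never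
touched. -/
theorem IsCompleteDescendingChain.levels_last {c : RelSeries (maximalSubringRel E)}
    (hf : (finitePart (FG E)).Finite) (hc : IsCompleteDescendingChain c) {p : ℕ} (hp : p.Prime) :
    levels q c.last p = {_k : ℕ | p ∈ infinitePart (FG E)} := by
  have h := (hc.1.sum_ncard_levels_add_length (q := q) hf).1 p hp
  rw [mem_infinitePart_iff (q := q), ← h, ← Set.Infinite]
  by_cases hfin : (levels q c.last p).Finite
  · rcases (levels q c.last p).eq_empty_or_nonempty with he | hne
    · simp [he]
    · obtain ⟨k, hk, hk'⟩ := exists_of_levels_finite hne hfin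
      exact absurd ⟨_, isMaximalSubringOf_iff.mpr ⟨p, hp, k, hk, hk', rfl⟩⟩ hc.2
  · simp [levels_eq_univ hfin, hp, Set.infinite_univ]

variable (q) in
include q in
theorem IsCompleteDescendingChain.length_eq {c : RelSeries (maximalSubringRel E)}
    (hf : (finitePart (FG E)).Finite) (hc : IsCompleteDescendingChain c) :
    (c.length : ℕ∞) = ∑ p ∈ hf.toFinset, fgOrder (FG E) p := by
  have h := (hc.1.sum_ncard_levels_add_length (q := q) hf).2
  rw [Finset.sum_eq_zero fun p hp => ?_, zero_add] at h
  · rw [h, Nat.cast_sum]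
    exact Finset.sum_congr rfl fun p hp =>
      (fgOrder_eq_ncard_levels ((Set.Finite.mem_toFinset hf).mp hp)).symm
  · have hp' := (Set.Finite.mem_toFinset hf).mp hp
    have hinf : p ∉ infinitePart (FG E) := fun h =>
      ((mem_infinitePart_iff (q := q)).mp h).2 ((mem_finitePart_iff (q := q)).mp hp').2.2
    rw [hc.levels_last hf hp'.1]
    simp [hinf]

variable (q) in
include q in
theorem IsCompleteDescendingChain.last_eq {c : RelSeries (maximalSubringRel E)}
    (hf : (finitePart (FG E)).Finite) (hc : IsCompleteDescendingChain c) :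
    c.last = (largestNonsubmaximalSubfield E).toSubring := by
  have : CharP E q := charP_of_injective_algebraMap (algebraMap (ZMod q) E).injective q
  have hq : ringChar E = q := ringChar.eq E q
  have hlev : ∀ (p k : ℕ), p.Prime →
      (p ^ (k + 1) ∈ absDegrees q c.last ↔ p ∈ infinitePart (FG E)) := fun p k hp =>
    Set.ext_iff.mp (hc.levels_last (q := q) hf hp) k
  apply le_antisymm
  · intro x hx
    obtain ⟨K, hK, hxK, -⟩ := exists_subfield_natCard (q := q) (x := x)
    refine (le_sSup (a := K) ⟨absDegree q x, ⟨?_, fun p hp hpx => ?_⟩, hq ▸ hK⟩ :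
      K ≤ largestNonsubmaximalSubfield E) hxK
    · rw [FG_eq_absDegrees (q := q)]
      exact ⟨x, Subring.mem_top x, dvd_rfl⟩
    · rw [← hlev p 0 hp]
      exact ⟨x, hx, by rwa [zero_add, pow_one]⟩
  · -- A subring of an absolutely algebraic field is closed under inverses.
    let L : Subfield E :=
      { c.last with
        inv_mem' := fun x hx => by
          obtain ⟨K, -, hxK, hKS⟩ := exists_subfield_natCard (q := q) (x := x)
          exact hKS c.last hx (K.inv_mem hxK) }
    suffices largestNonsubmaximalSubfield E ≤ L from this
    refine sSup_le ?_
    rintro K ⟨n, ⟨hn, hninf⟩, hK⟩ x hx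
    rw [hq] at hK
    rw [FG_eq_absDegrees (q := q)] at hn
    change x ∈ c.last
    rw [mem_iff_absDegree_mem (q := q)]
    refine mem_absDegrees_of_dvd (mem_absDegrees_of_prime_pow (ne_zero_of_mem_absDegrees hn) ?_)
      ((Subfield.mem_iff_absDegree_dvd (ne_zero_of_mem_absDegrees hn) hK).mp hx)
    intro p k hp hpk
    cases k with
    | zero => rw [pow_zero]; exact one_mem_absDegrees _
    | succ k => exact (hlev p k hp).mpr (hninf p hp ((dvd_pow_self p k.succ_ne_zero).trans hpk))

variable (q) in
include q in
theorem finite_setOf_isDescendingChain (hf : (finitePart (FG E)).Finite) :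
    {c : RelSeries (maximalSubringRel E) | IsDescendingChain c}.Finite := by
  have key : ∀ n, {c : RelSeries (maximalSubringRel E) | IsDescendingChain c ∧
      c.length = n}.Finite := by
    intro n
    induction n with
    | zero =>
      refine (Set.finite_singleton (RelSeries.singleton _ ⊤)).subset fun c ⟨hc, hn⟩ => ?_
      refine RelSeries.ext hn (funext fun i => ?_)
      have : i = 0 := by ext; have := i.2; simp; omega
      rw [this]
      exact hc
    | succ n ih =>
      refine (ih.biUnion (t := fun c => ⋃ S ∈ {S | IsMaximalSubringOf S c.last},
        {d | ∃ h : (c.last, S) ∈ maximalSubringRel E, d = c.snoc S h}) fun c hc =>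
          (finite_setOf_isMaximalSubringOf (q := q)
            (hc.1.sum_ncard_levels_add_length hf).1 hf).biUnion fun S _ =>
            Set.Subsingleton.finite ?_).subset fun c ⟨hc, hn⟩ => ?_
      · rintro _ ⟨_, rfl⟩ _ ⟨_, rfl⟩
        rfl
      · have hrel := c.eraseLast_last_rel_last (by omega)
        refine Set.mem_biUnion (x := c.eraseLast) ⟨hc, ?_⟩
          (Set.mem_biUnion (x := c.last) hrel ⟨hrel, ?_⟩)
        · rw [RelSeries.eraseLast_length, hn]; rfl
        · exact (c.snoc_self_eraseLast (by omega)).symm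
  refine ((Set.finite_Iic (∑ p ∈ hf.toFinset, (levels q (⊤ : Subring E) p).ncard)).biUnion
    fun n _ => key n).subset fun c hc => ?_
  have := (IsDescendingChain.sum_ncard_levels_add_length (q := q) hf hc).2
  exact Set.mem_biUnion (x := c.length) (Set.mem_Iic.mpr (by omega)) ⟨hc, rfl⟩

end Levels

/-! ### The equivalence and the structure of descending chains -/

theorem theorem2p6 {E : Type*} [Field E] :
    ((RgMax E).Finite ↔ ¬ ∃ R : ℕ → Subring E, IsInfiniteDescendingChain R) ∧
    ((RgMax E).Finite →
      IsAbsolutelyAlgebraic E ∧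
      (∃ hf : (finitePart (FG E)).Finite,
        ∀ c : RelSeries (maximalSubringRel E), IsCompleteDescendingChain c →
          (c.length : ℕ∞) = ∑ p ∈ hf.toFinset, fgOrder (FG E) p ∧
          c.last = (largestNonsubmaximalSubfield E).toSubring) ∧
      {c : RelSeries (maximalSubringRel E) | IsDescendingChain c}.Finite) := by
  by_cases hE : IsAbsolutelyAlgebraic E
  · obtain ⟨q, _, _, _⟩ := id hE
    refine ⟨⟨fun h => not_exists_isInfiniteDescendingChain q ((rgMax_finite_iff q).mp h),
      fun h => ?_⟩, fun h => ?_⟩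
    · by_contra hinf
      exact h (exists_isInfiniteDescendingChain_of_infinite q ((rgMax_finite_iff q).not.mp hinf))
    · have hf := (rgMax_finite_iff q).mp h
      exact ⟨hE, ⟨hf, fun c hc => ⟨hc.length_eq q hf, hc.last_eq q hf⟩⟩,
        finite_setOf_isDescendingChain q hf⟩
  · obtain ⟨hinf, hchain⟩ := rgMax_infinite_and_exists_chain_of_not_isAbsolutelyAlgebraic hE
    exact ⟨iff_of_false hinf fun h => h hchain, fun h => absurd h hinf⟩
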